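/- Let $n\ge 1$ be an integer. For $\nu\in\mathbb{R}$ and $r>0$ let $K_\nu$ be the Macdonald function, $r^\nu K_\nu(r)=2^{\nu-1}\int_0^\infty e^{-t-r^2/(4t)}\,t^{\nu-1}\,dt$, and for $\nu>-1$ and $r>0$ let $I_\nu(r)=\sum_{m\ge 0}\frac{(r/2)^{2m+\nu}}{m!\,\Gamma(m+\nu+1)}$ be the modified Bessel function of the first kind. For real $s>0$, $\alpha>0$ and $r>0$ put $$w_s^\alpha(r)=r^{2s}\,|K_s(r)|^2\,\frac{I_{\alpha+n/2-1}(2r)}{(2r)^{\alpha+n/2-1}}.$$ Then for every $\alpha>0$ there is a constant $c_\alpha>0$, depending only on $n$ and $\alpha$, such that for all real $s>0$ with $\alpha>\max\{2s-\frac{n+1}{2},0\}$ the following hold. The function $w_s^\alpha$ is positive and strictly decreasing on $(0,\infty)$. It extends continuously to $r=0$ with the value $$w_s^\alpha(0)=\lim_{r\to 0^+}w_s^\alpha(r)=2^{-\alpha-\frac n2+2s-1}\,\frac{\Gamma(s)^2}{\Gamma(\alpha+\frac n2)}.$$ Moreover $w_s^\alpha(r)\sim c_\alpha\,r^{-(\alpha+\frac{n+1}{2}-2s)}$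 as $r\to\infty$, that is, the quotient of the two sides tends to $1$. -/

import Mathlib

open Filter Topology Asymptotics

/-- The Macdonald function (modified Bessel function of the second kind) of real order `ν`, for
`r > 0`, through `r ^ ν * K_ν(r) = 2 ^ (ν - 1) * ∫₀^∞ exp (-t - r² / (4 t)) t ^ (ν - 1) dt`. -/
noncomputable def macdonaldK (ν r : ℝ) : ℝ :=
  r ^ (-ν) * (2 ^ (ν - 1) *
    ∫ t in Set.Ioi (0 : ℝ), Real.exp (-t - r ^ 2 / (4 * t)) * t ^ (ν - 1))

/-- The modified Bessel function of the first kind of real order `ν`, for `x > 0`: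
`I_ν(x) = ∑ₘ (x / 2) ^ (2 m + ν) / (m! Γ(m + ν + 1))`. -/
noncomputable def besselI (ν x : ℝ) : ℝ :=
  ∑' m : ℕ, (x / 2) ^ (2 * (m : ℝ) + ν) / ((Nat.factorial m : ℝ) * Real.Gamma ((m : ℝ) + ν + 1))

/-- The weight function `w_s^α`, as a function of the radial variable `r = |ξ| > 0`, `ξ ∈ ℝⁿ`, for
a real spectral parameter `s`. -/
noncomputable def weight (n : ℕ) (s α r : ℝ) : ℝ :=
  r ^ (2 * s) * |macdonaldK s r| ^ 2 *
    (besselI (α + (n : ℝ) / 2 - 1) (2 * r) / (2 * r) ^ (α + (n : ℝ) / 2 - 1))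

open MeasureTheory Set

/-! Put `ν = α + n/2 - 1`, so that `ν > -1/2` and `ν > 2s - 3/2`. Up to a constant the weight is
`(r^s K_s(r))² r^(-ν) I_ν(2r)`, and its derivative is negative exactly when `y := I_{ν+1}(2r) /
I_ν(2r)` is less than `z := K_{s-1}(r) / K_s(r)`. Turán-type inequalities give `y² + (ν + 1/2) y / r
< 1` (`besselSeries_turan`) and, for `s ≥ 1/2`, `z² + (2s - 1) z / r ≥ 1`
(`macdonaldIntegral_turan`). Since `2s - 1 ≤ ν + 1/2`, the positive root of `X² + (2s - 1) X / r =
1` separates `y` from `z`. For `s < 1/2`, simply `y < 1 ≤ z`.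

The value at `0` comes from dominated convergence to the Gamma integral. At infinity, Laplace's
method handles `K`; the behaviour of `I` then follows from the Wronskian of `I` and `K` and the
limit `I_{ν+1} / I_ν → 1`, with no integral representation of `I`. -/

theorem Real.one_add_sq_div_two_le_cosh (x : ℝ) : 1 + x ^ 2 / 2 ≤ Real.cosh x := by
  have h1 : Real.cosh x = 1 + 2 * Real.sinh (x / 2) ^ 2 := by
    have h := Real.cosh_two_mul (x / 2)
    rw [Real.cosh_sq, mul_div_cancel₀ x two_ne_zero] at h
    linarith
  have h2 : |x / 2| ≤ |Real.sinh (x / 2)| := by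
    rw [Real.abs_sinh]
    exact Real.self_le_sinh_iff.2 (abs_nonneg _)
  have h3 := sq_le_sq.2 h2
  rw [h1]
  nlinarith

/-! ### The Macdonald function: recurrences, derivatives and limits. -/

/-- The integral `∫ exp (ν u - r cosh u) du`, which is twice the Macdonald function. -/
noncomputable def macdonaldIntegral (ν r : ℝ) : ℝ :=
  ∫ u : ℝ, Real.exp (ν * u - r * Real.cosh u)

theorem integrable_exp_linear_sub_sq (ν : ℝ) {b : ℝ} (hb : 0 < b) :
    Integrable fun u : ℝ => Real.exp (ν * u - b * u ^ 2) := by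
  have h := ((integrable_exp_neg_mul_sq hb).comp_sub_right (ν / (2 * b))).const_mul
    (Real.exp (ν ^ 2 / (4 * b)))
  refine h.congr (ae_of_all _ fun u => ?_)
  simp only
  rw [← Real.exp_add]
  congr 1
  field_simp
  ring

theorem integrable_macdonald (ν : ℝ) {r : ℝ} (hr : 0 < r) :
    Integrable fun u : ℝ => Real.exp (ν * u - r * Real.cosh u) := by
  refine (integrable_exp_linear_sub_sq ν (half_pos hr)).mono'
    (by fun_prop) (ae_of_all _ fun u => ?_)
  rw [Real.norm_eq_abs, Real.abs_exp]
  apply Real.exp_le_exp.2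
  nlinarith [Real.one_add_sq_div_two_le_cosh u]

theorem macdonaldIntegral_pos (ν : ℝ) {r : ℝ} (hr : 0 < r) : 0 < macdonaldIntegral ν r :=
  integral_exp_pos (integrable_macdonald ν hr)

theorem macdonaldIntegral_neg (ν r : ℝ) : macdonaldIntegral (-ν) r = macdonaldIntegral ν r := by
  unfold macdonaldIntegral
  rw [← integral_neg_eq_self]
  simp

theorem two_mul_macdonaldIntegral (ν : ℝ) {r : ℝ} (hr : 0 < r) :
    2 * macdonaldIntegral ν r = ∫ u : ℝ, 2 * Real.cosh (ν * u) * Real.exp (-(r * Real.cosh u)) := by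
  rw [two_mul]
  nth_rewrite 2 [← macdonaldIntegral_neg]
  unfold macdonaldIntegral
  rw [← integral_add (integrable_macdonald ν hr) (integrable_macdonald (-ν) hr)]
  congr 1
  ext u
  rw [Real.cosh_eq (ν * u), sub_eq_add_neg, sub_eq_add_neg, Real.exp_add, Real.exp_add, neg_mul]
  ring

/-- After symmetrising under `u ↦ -u`, the order enters only through `cosh (ν u)`, which increases
with `|ν|`. -/
theorem macdonaldIntegral_le {a b r : ℝ} (hr : 0 < r) (hab : |a| ≤ |b|) :
    macdonaldIntegral a r ≤ macdonaldIntegral b r := by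
  have hint : ∀ c : ℝ, Integrable fun u : ℝ =>
      2 * Real.cosh (c * u) * Real.exp (-(r * Real.cosh u)) := fun c => by
    refine ((integrable_macdonald c hr).add (integrable_macdonald (-c) hr)).congr
      (ae_of_all _ fun u => ?_)
    simp only [Pi.add_apply]
    rw [Real.cosh_eq (c * u), sub_eq_add_neg, sub_eq_add_neg, Real.exp_add, Real.exp_add, neg_mul]
    ring
  have h : 2 * macdonaldIntegral a r ≤ 2 * macdonaldIntegral b r := by
    rw [two_mul_macdonaldIntegral a hr, two_mul_macdonaldIntegral b hr]
    refine integral_mono (hint a) (hint b) fun u => ?_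
    simp only
    gcongr 2 * ?_ * _
    rw [Real.cosh_le_cosh, abs_mul, abs_mul]
    gcongr
  linarith

theorem hasDerivAt_macdonaldIntegral (ν : ℝ) {r : ℝ} (hr : 0 < r) :
    HasDerivAt (macdonaldIntegral ν)
      (-(macdonaldIntegral (ν + 1) r + macdonaldIntegral (ν - 1) r) / 2) r := by
  have hexp : ∀ ρ u : ℝ, Real.cosh u * Real.exp (ν * u - ρ * Real.cosh u) =
      (Real.exp ((ν + 1) * u - ρ * Real.cosh u) + Real.exp ((ν - 1) * u - ρ * Real.cosh u)) / 2 := by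
    intro ρ u
    have h1 : (ν + 1) * u - ρ * Real.cosh u = u + (ν * u - ρ * Real.cosh u) := by ring
    have h2 : (ν - 1) * u - ρ * Real.cosh u = -u + (ν * u - ρ * Real.cosh u) := by ring
    rw [h1, h2, Real.exp_add, Real.exp_add, Real.cosh_eq]
    ring
  have hI : ∀ ρ : ℝ, 0 < ρ → Integrable fun u : ℝ =>
      Real.cosh u * Real.exp (ν * u - ρ * Real.cosh u) := fun ρ hρ => by
    simp_rw [hexp]
    exact ((integrable_macdonald _ hρ).add (integrable_macdonald _ hρ)).div_const 2
  have key := (hasDerivAt_integral_of_dominated_loc_of_deriv_le (μ := volume)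
    (F := fun ρ u : ℝ => Real.exp (ν * u - ρ * Real.cosh u))
    (F' := fun ρ u : ℝ => -(Real.cosh u * Real.exp (ν * u - ρ * Real.cosh u)))
    (bound := fun u : ℝ => Real.cosh u * Real.exp (ν * u - (r / 2) * Real.cosh u))
    (x₀ := r) (s := Ioi (r / 2)) (Ioi_mem_nhds (by linarith))
    (Eventually.of_forall fun ρ => by fun_prop) (integrable_macdonald ν hr)
    (by fun_prop)
    (ae_of_all _ fun u ρ hρ => by
      have hc := Real.cosh_pos u
      rw [norm_neg, norm_mul, Real.norm_eq_abs, Real.norm_eq_abs, Real.abs_exp, abs_of_pos hc]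
      have : r / 2 < ρ := hρ
      gcongr)
    (hI _ (half_pos hr))
    (ae_of_all _ fun u ρ hρ => by
      have h : HasDerivAt (fun ρ : ℝ => ν * u - ρ * Real.cosh u) (-Real.cosh u) ρ := by
        simpa using ((hasDerivAt_id ρ).mul_const (Real.cosh u)).const_sub (ν * u)
      exact h.exp.congr_deriv (by ring))).2
  refine key.congr_deriv ?_
  rw [integral_neg]
  simp_rw [hexp]
  rw [integral_div, integral_add (integrable_macdonald _ hr) (integrable_macdonald _ hr)]
  simp only [macdonaldIntegral]
  ring

/-- The integral over the line of the `u`-derivative of the integrand vanishes. -/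
theorem macdonaldIntegral_recurrence (ν : ℝ) {r : ℝ} (hr : 0 < r) :
    r * (macdonaldIntegral (ν + 1) r - macdonaldIntegral (ν - 1) r) =
      2 * ν * macdonaldIntegral ν r := by
  have hd : ∀ u : ℝ, HasDerivAt (fun u : ℝ => Real.exp (ν * u - r * Real.cosh u))
      (ν * Real.exp (ν * u - r * Real.cosh u) - r / 2 *
        (Real.exp ((ν + 1) * u - r * Real.cosh u) - Real.exp ((ν - 1) * u - r * Real.cosh u))) u := by
    intro u
    have h : HasDerivAt (fun u : ℝ => ν * u - r * Real.cosh u) (ν - r * Real.sinh u) u := by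
      simpa using ((hasDerivAt_id u).const_mul ν).fun_sub ((Real.hasDerivAt_cosh u).const_mul r)
    convert h.exp using 1
    have h1 : (ν + 1) * u - r * Real.cosh u = u + (ν * u - r * Real.cosh u) := by ring
    have h2 : (ν - 1) * u - r * Real.cosh u = -u + (ν * u - r * Real.cosh u) := by ring
    rw [h1, h2, Real.exp_add, Real.exp_add, Real.sinh_eq]
    ring
  have i0 := integrable_macdonald ν hr
  have i1 := integrable_macdonald (ν + 1) hr
  have i2 := integrable_macdonald (ν - 1) hr
  have i3 : Integrable fun u : ℝ => r / 2 *
      (Real.exp ((ν + 1) * u - r * Real.cosh u) - Real.exp ((ν - 1) * u - r * Real.cosh u)) :=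
    (i1.sub i2).const_mul (r / 2)
  have h := integral_eq_zero_of_hasDerivAt_of_integrable hd
    ((i0.const_mul ν).sub i3) i0
  rw [integral_sub (i0.const_mul ν) i3, integral_const_mul,
    integral_const_mul, integral_sub i1 i2] at h
  simp only [macdonaldIntegral]
  linarith

/-- With the next lemma, this gives a closed first-order system for the pair of orders `ν - 1`, `ν`;
every later derivative computation with `K` uses it. -/
theorem hasDerivAt_macdonaldIntegral' (ν : ℝ) {r : ℝ} (hr : 0 < r) :
    HasDerivAt (macdonaldIntegral ν)
      (-macdonaldIntegral (ν - 1) r - ν / r * macdonaldIntegral ν r) r := by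
  refine (hasDerivAt_macdonaldIntegral ν hr).congr_deriv ?_
  have := macdonaldIntegral_recurrence ν hr
  field_simp
  linarith

theorem hasDerivAt_macdonaldIntegral_sub_one (ν : ℝ) {r : ℝ} (hr : 0 < r) :
    HasDerivAt (macdonaldIntegral (ν - 1))
      ((ν - 1) / r * macdonaldIntegral (ν - 1) r - macdonaldIntegral ν r) r := by
  refine (hasDerivAt_macdonaldIntegral (ν - 1) hr).congr_deriv ?_
  have := macdonaldIntegral_recurrence (ν - 1) hr
  rw [sub_add_cancel] at this ⊢
  field_simp
  linarith

/-- Substitute `t = (r / 2) exp u`. -/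
theorem macdonaldK_eq (ν : ℝ) {r : ℝ} (hr : 0 < r) :
    macdonaldK ν r = macdonaldIntegral ν r / 2 := by
  have himg : (fun u : ℝ => r / 2 * Real.exp u) '' univ = Ioi 0 := by
    ext t
    simp only [image_univ, mem_range, mem_Ioi]
    constructor
    · rintro ⟨u, rfl⟩
      positivity
    · intro ht
      refine ⟨Real.log (t / (r / 2)), ?_⟩
      rw [Real.exp_log (by positivity)]
      field_simp
  have hint : ∫ t in Ioi (0 : ℝ), Real.exp (-t - r ^ 2 / (4 * t)) * t ^ (ν - 1) =
      (r / 2) ^ ν * macdonaldIntegral ν r := by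
    rw [← himg, integral_image_eq_integral_abs_deriv_smul MeasurableSet.univ
      (f' := fun u => r / 2 * Real.exp u)
      (fun u _ => ((Real.hasDerivAt_exp u).const_mul (r / 2)).hasDerivWithinAt)
      (fun u _ v _ h => by simpa [hr.ne'] using h), setIntegral_univ, macdonaldIntegral,
      ← integral_const_mul]
    congr 1
    ext u
    have hu := Real.exp_pos u
    have h1 : -(r / 2 * Real.exp u) - r ^ 2 / (4 * (r / 2 * Real.exp u)) = -(r * Real.cosh u) := by
      rw [Real.cosh_eq, Real.exp_neg]
      field_simp
      ring
    have h2 : (r / 2 * Real.exp u) ^ (ν - 1) * (r / 2 * Real.exp u) =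
        (r / 2) ^ ν * Real.exp (ν * u) := by
      rw [← Real.rpow_add_one (by positivity), sub_add_cancel,
        Real.mul_rpow (by positivity) hu.le, ← Real.exp_mul, mul_comm u]
    rw [abs_of_pos (by positivity), smul_eq_mul, h1, sub_eq_add_neg (ν * u), Real.exp_add,
      ← mul_assoc ((r / 2) ^ ν), ← h2]
    ring
  rw [macdonaldK, hint, Real.div_rpow hr.le zero_le_two, Real.rpow_neg hr.le,
    Real.rpow_sub_one two_ne_zero]
  have := Real.rpow_pos_of_pos hr ν
  have := Real.rpow_pos_of_pos (zero_lt_two (α := ℝ)) ν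
  field_simp

theorem tendsto_rpow_mul_macdonaldIntegral {s : ℝ} (hs : 0 < s) :
    Tendsto (fun r => r ^ s * macdonaldIntegral s r) (𝓝[>] 0) (𝓝 (2 ^ s * Real.Gamma s)) := by
  have hG : Tendsto (fun r : ℝ => ∫ t in Ioi (0 : ℝ),
      Real.exp (-t - r ^ 2 / (4 * t)) * t ^ (s - 1)) (𝓝[>] 0) (𝓝 (Real.Gamma s)) := by
    rw [Real.Gamma_eq_integral hs]
    refine tendsto_integral_filter_of_dominated_convergence
      (fun t => Real.exp (-t) * t ^ (s - 1)) (Eventually.of_forall fun r => ?_)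
      (Eventually.of_forall fun r => ?_) (Real.GammaIntegral_convergent hs) ?_
    · exact (by fun_prop : Measurable fun t : ℝ =>
        Real.exp (-t - r ^ 2 / (4 * t)) * t ^ (s - 1)).aestronglyMeasurable
    · filter_upwards [ae_restrict_mem measurableSet_Ioi] with t ht
      have ht : 0 < t := ht
      have : 0 ≤ r ^ 2 / (4 * t) := by positivity
      rw [Real.norm_of_nonneg (by positivity)]
      gcongr
      linarith
    · filter_upwards [ae_restrict_mem measurableSet_Ioi] with t ht
      have hc : Continuous fun r : ℝ => Real.exp (-t - r ^ 2 / (4 * t)) * t ^ (s - 1) := by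
        fun_prop
      simpa using (hc.tendsto 0).mono_left nhdsWithin_le_nhds
  refine (hG.const_mul (2 ^ s)).congr' ?_
  filter_upwards [self_mem_nhdsWithin] with r hr
  have hr : 0 < r := hr
  have h := macdonaldK_eq s hr
  rw [macdonaldK, Real.rpow_neg hr.le, Real.rpow_sub_one two_ne_zero] at h
  have := Real.rpow_pos_of_pos hr s
  have h' := congrArg (fun z => 2 * (r ^ s * z)) h
  rw [← mul_assoc (r ^ s), mul_inv_cancel₀ this.ne', one_mul] at h'
  linarith

/-- Laplace's method: after `u = x / √r` the integrand tends to `exp (-x² / 2)`, and `cosh y ≥ 1 +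
y² / 2` supplies a Gaussian majorant for `r ≥ 1`. -/
theorem tendsto_sqrt_mul_exp_mul_macdonaldIntegral (ν : ℝ) :
    Tendsto (fun r => √r * Real.exp r * macdonaldIntegral ν r) atTop (𝓝 √(2 * Real.pi)) := by
  have hlim : Tendsto (fun r : ℝ => ∫ x : ℝ,
      Real.exp (ν * (x / √r) - r * (Real.cosh (x / √r) - 1))) atTop (𝓝 √(2 * Real.pi)) := by
    have hG := integral_gaussian (1 / 2)
    rw [show Real.pi / (1 / 2) = 2 * Real.pi by ring] at hG
    rw [← hG]
    refine tendsto_integral_filter_of_dominated_convergence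
      (fun x => Real.exp (|ν| * x - 1 / 2 * x ^ 2) + Real.exp (-|ν| * x - 1 / 2 * x ^ 2))
      (Eventually.of_forall fun r => by fun_prop) ?_
      ((integrable_exp_linear_sub_sq _ one_half_pos).add
        (integrable_exp_linear_sub_sq _ one_half_pos)) (ae_of_all _ fun x => ?_)
    · filter_upwards [eventually_ge_atTop 1] with r hr
      refine ae_of_all _ fun x => ?_
      have hr0 : 0 < r := by linarith
      have hs : 1 ≤ √r := Real.one_le_sqrt.2 hr
      have hsq : r * (x / √r) ^ 2 = x ^ 2 := by
        rw [div_pow, Real.sq_sqrt hr0.le]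
        field_simp
      have h1 : x ^ 2 / 2 ≤ r * (Real.cosh (x / √r) - 1) := by
        have := mul_le_mul_of_nonneg_left (Real.one_add_sq_div_two_le_cosh (x / √r)) hr0.le
        linarith
      have h2 : ν * (x / √r) ≤ |ν| * |x| := by
        refine (le_abs_self _).trans ?_
        rw [abs_mul, abs_div, abs_of_nonneg (Real.sqrt_nonneg r)]
        gcongr
        exact div_le_self (abs_nonneg x) hs
      rw [Real.norm_eq_abs, Real.abs_exp]
      rcases abs_cases x with ⟨hx, -⟩ | ⟨hx, -⟩
      · refine (Real.exp_le_exp.2 ?_).trans (le_add_of_nonneg_right (Real.exp_pos _).le)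
        rw [hx] at h2
        linarith
      · refine (Real.exp_le_exp.2 ?_).trans (le_add_of_nonneg_left (Real.exp_pos _).le)
        rw [hx] at h2
        linarith
    · have hsqrt : Tendsto (fun r : ℝ => x / √r) atTop (𝓝 0) :=
        tendsto_const_nhds.div_atTop Real.tendsto_sqrt_atTop
      have hcosh : Tendsto (fun r : ℝ => r * (Real.cosh (x / √r) - 1)) atTop
          (𝓝 (1 / 2 * x ^ 2)) := by
        -- The half-angle formula `cosh y - 1 = 2 sinh² (y / 2)` reduces the second-order limit to
        -- `sinh y / y → 1`.
        have hslope : Tendsto (fun y : ℝ => dslope Real.sinh 0 y) (𝓝 0) (𝓝 1) := by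
          have := (continuousAt_dslope_same.2 (Real.differentiable_sinh 0)).tendsto
          simpa [dslope_same] using this
        have hy : Tendsto (fun r : ℝ => x / √r / 2) atTop (𝓝 0) := by
          simpa using hsqrt.div_const 2
        have h := ((hslope.comp hy).pow 2).const_mul (1 / 2 * x ^ 2)
        rw [one_pow, mul_one] at h
        refine h.congr' ?_
        filter_upwards [eventually_gt_atTop 0] with r hr
        have hS : Real.sinh (x / √r / 2) = x / √r / 2 * dslope Real.sinh 0 (x / √r / 2) := by
          have := sub_smul_dslope Real.sinh 0 (x / √r / 2)
          simpa using this.symm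
        have hC := Real.cosh_two_mul (x / √r / 2)
        rw [Real.cosh_sq, mul_div_cancel₀ _ two_ne_zero] at hC
        have hC' : Real.cosh (x / √r) - 1 = 2 * Real.sinh (x / √r / 2) ^ 2 := by linarith
        rw [hC', hS, Function.comp_apply, mul_pow, div_pow, div_pow, Real.sq_sqrt hr.le]
        field_simp
      have h := ((hsqrt.const_mul ν).sub hcosh)
      rw [mul_zero, zero_sub, ← neg_mul] at h
      exact (Real.continuous_exp.tendsto _).comp h
  refine hlim.congr' ?_
  filter_upwards [eventually_gt_atTop 0] with r hr
  have hs : 0 < √r := Real.sqrt_pos.2 hr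
  rw [Measure.integral_comp_div (fun y : ℝ => Real.exp (ν * y - r * (Real.cosh y - 1))) (√r),
    abs_of_pos hs, smul_eq_mul, mul_assoc, macdonaldIntegral,
    ← integral_const_mul (Real.exp r)]
  congr 1
  refine integral_congr_ae (ae_of_all _ fun u => ?_)
  simp only
  rw [← Real.exp_add]
  congr 1
  ring

/-! ### The power series of the Bessel function `I`. -/

/-- The entire function `∑ y ^ m / (m! Γ(m + ν + 1))`, so that
`I_ν(2 r) = r ^ ν * besselSeries ν (r ^ 2)`. -/
noncomputable def besselSeries (ν y : ℝ) : ℝ :=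
  ∑' m : ℕ, y ^ m / ((Nat.factorial m : ℝ) * Real.Gamma ((m : ℝ) + ν + 1))

theorem Gamma_nat_add_pos {ν : ℝ} (hν : -1 < ν) (m : ℕ) : 0 < Real.Gamma ((m : ℝ) + ν + 1) :=
  Real.Gamma_pos_of_pos (by have : (0 : ℝ) ≤ m := m.cast_nonneg; linarith)

theorem exists_le_Gamma_nat_add {ν : ℝ} (hν : -1 < ν) :
    ∃ δ : ℝ, 0 < δ ∧ ∀ m : ℕ, δ ≤ Real.Gamma ((m : ℝ) + ν + 1) := by
  -- Gamma need not increase from `ν + 1` to `ν + 2`, so `m = 0` is treated apart; from `m = 1` on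
  -- the argument is at least `1` and `Γ(x + 1) = x Γ(x)` gives growth.
  refine ⟨min (Real.Gamma (ν + 1)) (Real.Gamma (ν + 2)),
    lt_min (Real.Gamma_pos_of_pos (by linarith)) (Real.Gamma_pos_of_pos (by linarith)), ?_⟩
  have h : ∀ m : ℕ, Real.Gamma (ν + 2) ≤ Real.Gamma (((m + 1 : ℕ) : ℝ) + ν + 1) := by
    intro m
    induction m with
    | zero => apply le_of_eq; congr 1; push_cast; ring
    | succ k ih =>
      have hk : (0 : ℝ) ≤ k := k.cast_nonneg
      have hpos := Gamma_nat_add_pos hν (k + 1)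
      have he : (((k + 1 + 1 : ℕ) : ℝ) + ν + 1) = (((k + 1 : ℕ) : ℝ) + ν + 1) + 1 := by
        push_cast; ring
      have h1 : (1 : ℝ) ≤ ((k + 1 : ℕ) : ℝ) + ν + 1 := by push_cast; linarith
      rw [he, Real.Gamma_add_one (by linarith)]
      exact ih.trans (le_mul_of_one_le_left hpos.le h1)
  rintro (_ | m)
  · simp
  · exact (min_le_right _ _).trans (h m)

theorem summable_besselSeries {ν : ℝ} (hν : -1 < ν) (y : ℝ) :
    Summable fun m : ℕ => y ^ m / ((Nat.factorial m : ℝ) * Real.Gamma ((m : ℝ) + ν + 1)) := by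
  obtain ⟨δ, hδ, h⟩ := exists_le_Gamma_nat_add hν
  refine Summable.of_norm_bounded ((Real.summable_pow_div_factorial |y|).mul_right δ⁻¹) fun m => ?_
  have hG := Gamma_nat_add_pos hν m
  have hf : (0 : ℝ) < Nat.factorial m := by positivity
  rw [norm_div, norm_pow, Real.norm_eq_abs, Real.norm_of_nonneg (by positivity), ← div_eq_mul_inv,
    div_div]
  gcongr
  exact h m

theorem besselSeries_pos {ν : ℝ} (hν : -1 < ν) {y : ℝ} (hy : 0 ≤ y) : 0 < besselSeries ν y := by
  refine (summable_besselSeries hν y).tsum_pos (fun m => ?_) 0 ?_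
  · have := Gamma_nat_add_pos hν m
    positivity
  · have := Gamma_nat_add_pos hν 0
    simpa using this

theorem besselSeries_zero (ν : ℝ) : besselSeries ν 0 = (Real.Gamma (ν + 1))⁻¹ := by
  rw [besselSeries, tsum_eq_single 0 fun m hm => by simp [hm]]
  simp

theorem hasDerivAt_besselSeries {ν : ℝ} (hν : -1 < ν) (y : ℝ) :
    HasDerivAt (besselSeries ν) (besselSeries (ν + 1) y) y := by
  obtain ⟨δ, hδ, hΓ⟩ := exists_le_Gamma_nat_add hν
  set R := |y| + 1 with hR
  have hR0 : 0 < R := by positivity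
  -- Majorant of the differentiated terms on the ball of radius `R` about `0`. The truncated
  -- exponent at `m = 0` is harmless because of the factor `m`.
  let u : ℕ → ℝ := fun m => (m : ℝ) * R ^ (m - 1) / ((Nat.factorial m : ℝ) * δ)
  have hu : Summable u := by
    rw [← summable_nat_add_iff 1]
    refine ((Real.summable_pow_div_factorial R).mul_right δ⁻¹).congr fun m => ?_
    simp only [u, Nat.factorial_succ, Nat.add_sub_cancel]
    push_cast
    field_simp
  have key := hasDerivAt_tsum_of_isPreconnected (𝕜 := ℝ) (u := u)
    (g := fun (m : ℕ) y => y ^ m / ((Nat.factorial m : ℝ) * Real.Gamma ((m : ℝ) + ν + 1)))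
    (g' := fun (m : ℕ) y => (m : ℝ) * y ^ (m - 1) /
      ((Nat.factorial m : ℝ) * Real.Gamma ((m : ℝ) + ν + 1)))
    (t := Metric.ball 0 R) (y₀ := 0) (y := y) hu Metric.isOpen_ball
    (convex_ball (0 : ℝ) R).isPreconnected
    (fun m z _ => (hasDerivAt_pow m z).div_const _)
    (fun m z hz => by
      have hz : |z| < R := by simpa using hz
      have hG := Gamma_nat_add_pos hν m
      have hf : (0 : ℝ) < Nat.factorial m := by positivity
      rw [norm_div, norm_mul, norm_pow, Real.norm_eq_abs z, Real.norm_of_nonneg (by positivity),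
        Real.norm_of_nonneg (by positivity)]
      simp only [u]
      gcongr
      exact hΓ m)
    (by simpa using hR0) (summable_besselSeries hν 0) (by simp [hR])
  refine key.congr_deriv ?_
  have hs : Summable fun m : ℕ => (m : ℝ) * y ^ (m - 1) /
      ((Nat.factorial m : ℝ) * Real.Gamma ((m : ℝ) + ν + 1)) := by
    rw [← summable_nat_add_iff 1]
    refine (summable_besselSeries (ν := ν + 1) (by linarith) y).congr fun m => ?_
    have hf : (0 : ℝ) < Nat.factorial m := by positivity
    have hG := Gamma_nat_add_pos hν (m + 1)
    simp only [Nat.factorial_succ, Nat.add_sub_cancel]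
    push_cast at hG ⊢
    rw [show (m : ℝ) + (ν + 1) + 1 = m + 1 + ν + 1 by ring]
    field_simp
  rw [hs.tsum_eq_zero_add, besselSeries]
  simp only [CharP.cast_eq_zero, zero_mul, zero_div, zero_add]
  congr 1
  ext m
  have hf : (0 : ℝ) < Nat.factorial m := by positivity
  have hG := Gamma_nat_add_pos hν (m + 1)
  simp only [Nat.factorial_succ, Nat.add_sub_cancel]
  push_cast at hG ⊢
  rw [show (m : ℝ) + (ν + 1) + 1 = m + 1 + ν + 1 by ring]
  field_simp

/-- Termwise, `1 / Γ(m + ν + 1) = (m + ν + 1) / Γ(m + ν + 2)`; split the numerator into `ν + 1` and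
`m`. -/
theorem besselSeries_recurrence {ν : ℝ} (hν : -1 < ν) (y : ℝ) :
    besselSeries ν y = (ν + 1) * besselSeries (ν + 1) y + y * besselSeries (ν + 2) y := by
  have s1 := (summable_besselSeries (ν := ν + 1) (by linarith) y).mul_left (ν + 1)
  have s2 := (summable_besselSeries (ν := ν + 2) (by linarith) y).mul_left y
  have s3 : Summable fun m : ℕ =>
      (m : ℝ) * y ^ m / ((Nat.factorial m : ℝ) * Real.Gamma ((m : ℝ) + (ν + 1) + 1)) := by
    rw [← summable_nat_add_iff 1]
    refine s2.congr fun m => ?_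
    have hf : (0 : ℝ) < Nat.factorial m := by positivity
    have hG := Gamma_nat_add_pos (ν := ν + 2) (by linarith) m
    simp only [Nat.factorial_succ]
    push_cast
    rw [show (m : ℝ) + 1 + (ν + 1) + 1 = m + (ν + 2) + 1 by ring]
    field_simp
    ring
  have h3 : ∑' m : ℕ, (m : ℝ) * y ^ m /
      ((Nat.factorial m : ℝ) * Real.Gamma ((m : ℝ) + (ν + 1) + 1)) = y * besselSeries (ν + 2) y := by
    rw [s3.tsum_eq_zero_add, besselSeries, ← tsum_mul_left]
    simp only [CharP.cast_eq_zero, zero_mul, zero_div, zero_add]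
    congr 1
    ext m
    have hf : (0 : ℝ) < Nat.factorial m := by positivity
    have hG := Gamma_nat_add_pos (ν := ν + 2) (by linarith) m
    simp only [Nat.factorial_succ]
    push_cast
    rw [show (m : ℝ) + 1 + (ν + 1) + 1 = m + (ν + 2) + 1 by ring]
    field_simp
    ring
  rw [← h3]
  simp only [besselSeries]
  rw [← tsum_mul_left, ← s1.tsum_add s3]
  congr 1
  ext m
  have hf : (0 : ℝ) < Nat.factorial m := by positivity
  have hG := Gamma_nat_add_pos hν m
  have hm : (0 : ℝ) < m + ν + 1 := by have : (0 : ℝ) ≤ m := m.cast_nonneg; linarith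
  rw [show (m : ℝ) + (ν + 1) + 1 = m + ν + 1 + 1 by ring, Real.Gamma_add_one hm.ne']
  field_simp
  ring

theorem besselI_two_mul (ν : ℝ) {r : ℝ} (hr : 0 < r) :
    besselI ν (2 * r) = r ^ ν * besselSeries ν (r ^ 2) := by
  rw [besselI, besselSeries, ← tsum_mul_left]
  congr 1
  ext m
  rw [mul_div_cancel_left₀ _ two_ne_zero, Real.rpow_add hr, ← pow_mul,
    show 2 * (m : ℝ) = ((2 * m : ℕ) : ℝ) by push_cast; ring, Real.rpow_natCast]
  ring

theorem hasDerivAt_besselSeries_sq {ν : ℝ} (hν : -1 < ν) (r : ℝ) :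
    HasDerivAt (fun r => besselSeries ν (r ^ 2)) (2 * r * besselSeries (ν + 1) (r ^ 2)) r := by
  have h := (hasDerivAt_besselSeries hν (r ^ 2)).comp r (hasDerivAt_pow 2 r)
  refine h.congr_deriv ?_
  push_cast
  ring

theorem continuous_besselSeries_sq {ν : ℝ} (hν : -1 < ν) :
    Continuous fun r : ℝ => besselSeries ν (r ^ 2) :=
  continuous_iff_continuousAt.2 fun r => (hasDerivAt_besselSeries_sq hν r).continuousAt

theorem sq_mul_besselSeries_add_two {ν : ℝ} (hν : -1 < ν) (r : ℝ) :
    r ^ 2 * besselSeries (ν + 1 + 1) (r ^ 2) =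
      besselSeries ν (r ^ 2) - (ν + 1) * besselSeries (ν + 1) (r ^ 2) := by
  rw [show ν + 1 + 1 = ν + 2 by ring]
  linarith [besselSeries_recurrence hν (r ^ 2)]

/-! ### Turán-type inequalities and the comparison of the two ratios. -/

/-- The Riccati form of the monotonicity of `I_{ν+1} / I_ν` for `ν > -1/2`. -/
theorem besselSeries_turan {ν r : ℝ} (hν : -1 / 2 < ν) (hr : 0 < r) :
    (ν + 1 / 2) * (besselSeries ν (r ^ 2) * besselSeries (ν + 1) (r ^ 2)) +
      r ^ 2 * besselSeries (ν + 1) (r ^ 2) ^ 2 < besselSeries ν (r ^ 2) ^ 2 := by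
  have hν1 : -1 < ν := by linarith
  have hν2 : -1 < ν + 1 := by linarith
  -- The factor `x ^ (2 * ν + 1)` makes the derivative a single positive term and forces `h 0 = 0`,
  -- its exponent being positive.
  set h : ℝ → ℝ := fun x => x ^ (2 * ν + 1) * (besselSeries ν (x ^ 2) ^ 2 -
    x ^ 2 * besselSeries (ν + 1) (x ^ 2) ^ 2 -
    (ν + 1 / 2) * (besselSeries ν (x ^ 2) * besselSeries (ν + 1) (x ^ 2))) with hh
  have hd : ∀ x : ℝ, 0 < x → HasDerivAt h (x ^ (2 * ν) * ((ν + 1 / 2) *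
      (besselSeries ν (x ^ 2) * besselSeries (ν + 1) (x ^ 2)))) x := by
    intro x hx
    have db := hasDerivAt_besselSeries_sq hν1 x
    have dd := hasDerivAt_besselSeries_sq hν2 x
    have dp := Real.hasDerivAt_rpow_const (x := x) (p := 2 * ν + 1) (Or.inl hx.ne')
    have e := sq_mul_besselSeries_add_two hν1 x
    have hD := dp.mul (((db.pow 2).sub ((hasDerivAt_pow 2 x).mul (dd.pow 2))).sub
      ((db.mul dd).const_mul (ν + 1 / 2)))
    refine HasDerivAt.congr_deriv (f := h) hD ?_
    simp only [Pi.mul_apply, Pi.pow_apply, Pi.sub_apply]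
    rw [Real.rpow_add_one hx.ne', add_sub_cancel_right]
    generalize x ^ (2 * ν) = p
    generalize besselSeries ν (x ^ 2) = b at *
    generalize besselSeries (ν + 1) (x ^ 2) = d at *
    generalize besselSeries (ν + 1 + 1) (x ^ 2) = k at *
    push_cast
    linear_combination p * (-4 * x ^ 2 * d - (2 * ν + 1) * b) * e
  have hc : ContinuousOn h (Ici 0) := by
    have c1 := continuous_besselSeries_sq hν1
    have c2 := continuous_besselSeries_sq hν2
    have c3 : Continuous fun x : ℝ => x ^ (2 * ν + 1) :=
      Real.continuous_rpow_const (by linarith)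
    exact Continuous.continuousOn (by fun_prop)
  have hm : StrictMonoOn h (Ici 0) := strictMonoOn_of_deriv_pos (convex_Ici 0) hc fun x hx => by
    rw [interior_Ici] at hx
    have hx : 0 < x := hx
    rw [(hd x hx).deriv]
    have h1 := besselSeries_pos hν1 (sq_nonneg x)
    have h2 := besselSeries_pos hν2 (sq_nonneg x)
    have h3 : 0 < ν + 1 / 2 := by linarith
    positivity
  have h0 := hm (self_mem_Ici) (mem_Ici.2 hr.le) hr
  simp only [hh] at h0
  rw [Real.zero_rpow (by linarith), zero_mul] at h0
  have := pos_of_mul_pos_right h0 (Real.rpow_nonneg hr.le _)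
  linarith

theorem mul_besselSeries_add_one_lt {ν r : ℝ} (hν : -1 / 2 < ν) (hr : 0 < r) :
    r * besselSeries (ν + 1) (r ^ 2) < besselSeries ν (r ^ 2) := by
  have h1 := besselSeries_pos (ν := ν) (by linarith) (sq_nonneg r)
  have h2 := besselSeries_pos (ν := ν + 1) (by linarith) (sq_nonneg r)
  have h3 : 0 < ν + 1 / 2 := by linarith
  have h := besselSeries_turan hν hr
  refine lt_of_pow_lt_pow_left₀ 2 h1.le ?_
  rw [mul_pow]
  have : 0 < (ν + 1 / 2) * (besselSeries ν (r ^ 2) * besselSeries (ν + 1) (r ^ 2)) := by positivity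
  linarith

theorem tendsto_sqrt_mul_macdonaldIntegral (ν : ℝ) :
    Tendsto (fun r => √r * macdonaldIntegral ν r) atTop (𝓝 0) := by
  have h := (tendsto_sqrt_mul_exp_mul_macdonaldIntegral ν).mul Real.tendsto_exp_neg_atTop_nhds_zero
  rw [mul_zero] at h
  refine h.congr fun r => ?_
  have : Real.exp r * Real.exp (-r) = 1 := by rw [← Real.exp_add, add_neg_cancel, Real.exp_zero]
  linear_combination (√r * macdonaldIntegral ν r) * this

/-- The Riccati form of the monotonicity of `K_{s-1} / K_s` for `s ≥ 1/2`. -/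
theorem macdonaldIntegral_turan {s r : ℝ} (hs : 1 / 2 ≤ s) (hr : 0 < r) :
    r * macdonaldIntegral s r ^ 2 ≤ r * macdonaldIntegral (s - 1) r ^ 2 +
      (2 * s - 1) * (macdonaldIntegral (s - 1) r * macdonaldIntegral s r) := by
  -- Here the boundary condition is at infinity: `f` is antitone with limit `0`, hence nonnegative.
  set f : ℝ → ℝ := fun x => x * (macdonaldIntegral (s - 1) x ^ 2 - macdonaldIntegral s x ^ 2) +
    (2 * s - 1) * (macdonaldIntegral (s - 1) x * macdonaldIntegral s x) with hf
  have hd : ∀ x : ℝ, 0 < x → HasDerivAt f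
      (-((2 * s - 1) * (macdonaldIntegral (s - 1) x * macdonaldIntegral s x) / x)) x := by
    intro x hx
    have da := hasDerivAt_macdonaldIntegral_sub_one s hx
    have db := hasDerivAt_macdonaldIntegral' s hx
    have hD := ((hasDerivAt_id x).mul ((da.pow 2).sub (db.pow 2))).add
      ((da.mul db).const_mul (2 * s - 1))
    refine HasDerivAt.congr_deriv (f := f) hD ?_
    simp only [Pi.pow_apply, Pi.sub_apply, id]
    push_cast
    field_simp
    ring
  have hanti : AntitoneOn f (Ioi 0) := antitoneOn_of_deriv_nonpos (convex_Ioi 0)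
    (fun x hx => (hd x hx).continuousAt.continuousWithinAt)
    (fun x hx => (hd x (by simpa using hx)).differentiableAt.differentiableWithinAt) fun x hx => by
      have hx : 0 < x := by simpa using hx
      rw [(hd x hx).deriv, neg_nonpos]
      have h1 := macdonaldIntegral_pos (s - 1) hx
      have h2 := macdonaldIntegral_pos s hx
      have h3 : 0 ≤ 2 * s - 1 := by linarith
      positivity
  have hlim : Tendsto f atTop (𝓝 0) := by
    have ta := tendsto_sqrt_mul_macdonaldIntegral (s - 1)
    have tb := tendsto_sqrt_mul_macdonaldIntegral s
    have h := (((ta.pow 2).sub (tb.pow 2))).add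
      (((ta.mul tb).mul tendsto_inv_atTop_zero).const_mul (2 * s - 1))
    simp only [ne_eq, OfNat.ofNat_ne_zero, not_false_eq_true, zero_pow, sub_zero, mul_zero,
      add_zero] at h
    refine h.congr' ?_
    filter_upwards [eventually_gt_atTop 0] with x hx
    have hq := Real.sq_sqrt hx.le
    have hi : x * x⁻¹ = 1 := mul_inv_cancel₀ hx.ne'
    simp only [hf]
    generalize macdonaldIntegral (s - 1) x = a
    generalize macdonaldIntegral s x = b
    linear_combination (a ^ 2 - b ^ 2 + (2 * s - 1) * a * b * x⁻¹) * hq + (2 * s - 1) * a * b * hi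
  have h0 : 0 ≤ f r := le_of_tendsto hlim <| by
    filter_upwards [eventually_ge_atTop r] with x hx
    exact hanti hr (lt_of_lt_of_le hr hx) hx
  simp only [hf] at h0
  linarith

theorem besselSeries_mul_macdonaldIntegral_lt {ν s r : ℝ} (hν : -1 / 2 < ν) (hs : 0 < s)
    (hsν : 2 * s - 3 / 2 ≤ ν) (hr : 0 < r) :
    r * besselSeries (ν + 1) (r ^ 2) * macdonaldIntegral s r <
      besselSeries ν (r ^ 2) * macdonaldIntegral (s - 1) r := by
  have hb := besselSeries_pos (ν := ν) (by linarith) (sq_nonneg r)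
  have hd := besselSeries_pos (ν := ν + 1) (by linarith) (sq_nonneg r)
  have hE := macdonaldIntegral_pos s hr
  have hE' := macdonaldIntegral_pos (s - 1) hr
  rcases lt_or_ge s (1 / 2) with h | h
  · have h1 := mul_besselSeries_add_one_lt hν hr
    have h2 : macdonaldIntegral s r ≤ macdonaldIntegral (s - 1) r :=
      macdonaldIntegral_le hr (by rw [abs_of_pos hs, abs_of_neg (by linarith)]; linarith)
    calc _ < besselSeries ν (r ^ 2) * macdonaldIntegral s r := by gcongr
      _ ≤ _ := by gcongr
  · have hf := macdonaldIntegral_turan h hr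
    have hg := besselSeries_turan hν hr
    generalize besselSeries ν (r ^ 2) = b at *
    generalize besselSeries (ν + 1) (r ^ 2) = d at *
    generalize macdonaldIntegral s r = e at *
    generalize macdonaldIntegral (s - 1) r = k at *
    -- If `b k ≤ r d e`, inserting this bound into `hf` multiplied by `b²` contradicts `hg'`
    -- multiplied by `r e²`.
    by_contra! hle
    have hg' : (2 * s - 1) * (b * d) + r ^ 2 * d ^ 2 < b ^ 2 := by
      have : (2 * s - 1) * (b * d) ≤ (ν + 1 / 2) * (b * d) := by gcongr; linarith
      linarith
    have h1 := mul_lt_mul_of_pos_right hg' (by positivity : 0 < r * e ^ 2)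
    have h2 := mul_le_mul_of_nonneg_right hf (sq_nonneg b)
    have hk : 0 ≤ 2 * s - 1 := by linarith
    have h3 : (2 * s - 1) * (b * e) * (b * k) ≤ (2 * s - 1) * (b * e) * (r * d * e) := by gcongr
    have h4 : r * (b * k) ^ 2 ≤ r * (r * d * e) ^ 2 := by gcongr
    nlinarith

/-! ### The Wronskian and the growth of `I` at infinity. -/

theorem tendsto_rpow_mul_macdonaldIntegral_two_mul {ν : ℝ} (hν : 0 < ν) :
    Tendsto (fun r => r ^ ν * macdonaldIntegral ν (2 * r)) (𝓝[>] 0) (𝓝 (Real.Gamma ν)) := by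
  have ht : Tendsto (fun r : ℝ => 2 * r) (𝓝[>] 0) (𝓝[>] 0) := by
    refine tendsto_nhdsWithin_iff.2 ⟨?_, ?_⟩
    · have : Tendsto (fun r : ℝ => 2 * r) (𝓝 0) (𝓝 (2 * 0)) := tendsto_id.const_mul 2
      rw [mul_zero] at this
      exact this.mono_left nhdsWithin_le_nhds
    · filter_upwards [self_mem_nhdsWithin] with r hr
      exact mul_pos two_pos (mem_Ioi.1 hr)
  have h := ((tendsto_rpow_mul_macdonaldIntegral hν).comp ht).const_mul ((2 : ℝ) ^ ν)⁻¹
  have h2 := Real.rpow_pos_of_pos (zero_lt_two (α := ℝ)) ν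
  rw [← mul_assoc, inv_mul_cancel₀ h2.ne', one_mul] at h
  refine h.congr' ?_
  filter_upwards [self_mem_nhdsWithin] with r hr
  have hr : 0 < r := hr
  rw [Function.comp_apply, Real.mul_rpow zero_le_two hr.le]
  field_simp

/-- The Wronskian identity `I_ν K_{ν+1} + I_{ν+1} K_ν = 1 / x` at `x = 2 r`. -/
theorem besselSeries_wronskian {ν r : ℝ} (hν : -1 / 2 < ν) (hr : 0 < r) :
    r ^ (ν + 1) * (besselSeries ν (r ^ 2) * macdonaldIntegral (ν + 1) (2 * r) +
      r * besselSeries (ν + 1) (r ^ 2) * macdonaldIntegral ν (2 * r)) = 1 := by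
  have hν1 : -1 < ν := by linarith
  have hν2 : -1 < ν + 1 := by linarith
  -- `W` has zero derivative, so it equals its limit at `0`.
  set W : ℝ → ℝ := fun x => x ^ (ν + 1) *
    (besselSeries ν (x ^ 2) * macdonaldIntegral (ν + 1) (2 * x) +
      x * besselSeries (ν + 1) (x ^ 2) * macdonaldIntegral ν (2 * x)) with hW
  have hd : ∀ x : ℝ, 0 < x → HasDerivAt W 0 x := by
    intro x hx
    have hx2 : 0 < 2 * x := by positivity
    have d2 : HasDerivAt (fun x : ℝ => 2 * x) 2 x := by simpa using (hasDerivAt_id x).const_mul 2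
    have db := hasDerivAt_besselSeries_sq hν1 x
    have dd := hasDerivAt_besselSeries_sq hν2 x
    have dp := Real.hasDerivAt_rpow_const (x := x) (p := ν + 1) (Or.inl hx.ne')
    have dA := (hasDerivAt_macdonaldIntegral' (ν + 1) hx2).comp x d2
    have dB := (hasDerivAt_macdonaldIntegral_sub_one (ν + 1) hx2).comp x d2
    rw [add_sub_cancel_right] at dA dB
    have e := sq_mul_besselSeries_add_two hν1 x
    have hD := dp.mul ((db.mul dA).add (((hasDerivAt_id x).mul dd).mul dB))
    refine HasDerivAt.congr_deriv (f := W) hD ?_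
    simp only [Pi.mul_apply, Pi.add_apply, Function.comp_apply, id]
    rw [Real.rpow_add_one hx.ne', add_sub_cancel_right]
    generalize x ^ ν = p
    generalize besselSeries ν (x ^ 2) = b at *
    generalize besselSeries (ν + 1) (x ^ 2) = d at *
    generalize besselSeries (ν + 1 + 1) (x ^ 2) = k at *
    generalize macdonaldIntegral ν (2 * x) = B at *
    generalize macdonaldIntegral (ν + 1) (2 * x) = A at *
    field_simp
    linear_combination 2 * B * p * x * e
  have hlim : Tendsto W (𝓝[>] 0) (𝓝 1) := by
    have tA := tendsto_rpow_mul_macdonaldIntegral_two_mul (ν := ν + 1) (by linarith)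
    have tb : Tendsto (fun x : ℝ => besselSeries ν (x ^ 2)) (𝓝[>] 0)
        (𝓝 (Real.Gamma (ν + 1))⁻¹) := by
      have h := ((continuous_besselSeries_sq hν1).tendsto 0).mono_left
        (nhdsWithin_le_nhds (s := Ioi 0))
      simpa [besselSeries_zero] using h
    have td : Tendsto (fun x : ℝ => x * besselSeries (ν + 1) (x ^ 2)) (𝓝[>] 0) (𝓝 0) := by
      have h := ((continuous_id.fun_mul (continuous_besselSeries_sq hν2)).tendsto 0).mono_left
        (nhdsWithin_le_nhds (s := Ioi 0))
      simpa using h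
    have hG := Real.Gamma_pos_of_pos (s := ν + 1) (by linarith)
    have t1 := tb.mul tA
    rw [inv_mul_cancel₀ hG.ne'] at t1
    -- Since `|ν| ≤ ν + 1`, order `ν` is dominated by order `ν + 1`; this avoids the separate
    -- behaviour of `K_ν` at `0` when `ν ≤ 0`.
    have t2 : Tendsto (fun x : ℝ => x * besselSeries (ν + 1) (x ^ 2) *
        (x ^ (ν + 1) * macdonaldIntegral ν (2 * x))) (𝓝[>] 0) (𝓝 0) := by
      have t3 := td.mul tA
      rw [zero_mul] at t3
      refine tendsto_of_tendsto_of_tendsto_of_le_of_le' tendsto_const_nhds t3 ?_ ?_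
      · filter_upwards [self_mem_nhdsWithin] with x hx
        have hx : 0 < x := hx
        have h1 := besselSeries_pos hν2 (sq_nonneg x)
        have h2 := macdonaldIntegral_pos ν (by positivity : 0 < 2 * x)
        positivity
      · filter_upwards [self_mem_nhdsWithin] with x hx
        have hx : 0 < x := hx
        have h1 := besselSeries_pos hν2 (sq_nonneg x)
        have h2 : macdonaldIntegral ν (2 * x) ≤ macdonaldIntegral (ν + 1) (2 * x) := by
          refine macdonaldIntegral_le (by positivity) ?_
          rw [abs_of_pos (by linarith : 0 < ν + 1), abs_le]
          constructor <;> linarith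
        gcongr
    have t := t1.add t2
    rw [add_zero] at t
    refine t.congr fun x => ?_
    simp only [hW]
    ring
  have hconst : ∀ x : ℝ, 0 < x → W x = W r := fun x hx =>
    isOpen_Ioi.is_const_of_deriv_eq_zero isPreconnected_Ioi
      (fun y hy => (hd y hy).differentiableAt.differentiableWithinAt)
      (fun y hy => (hd y hy).deriv) (mem_Ioi.2 hx) (mem_Ioi.2 hr)
  have hlim' : Tendsto W (𝓝[>] 0) (𝓝 (W r)) := by
    refine tendsto_const_nhds.congr' ?_
    filter_upwards [self_mem_nhdsWithin] with x hx
    exact (hconst x hx).symm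
  exact tendsto_nhds_unique hlim' hlim

/-- The ratio is below `1`. The same bound at order `ν + 1`, put into the recurrence, shows that it
exceeds `r / (r + ν + 1)`. -/
theorem tendsto_besselSeries_ratio {ν : ℝ} (hν : -1 / 2 < ν) :
    Tendsto (fun r : ℝ => r * besselSeries (ν + 1) (r ^ 2) / besselSeries ν (r ^ 2)) atTop
      (𝓝 1) := by
  have hlow : Tendsto (fun r : ℝ => (1 + (ν + 1) * r⁻¹)⁻¹) atTop (𝓝 1) := by
    have h := ((tendsto_inv_atTop_zero (𝕜 := ℝ)).const_mul (ν + 1)).const_add 1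
    rw [mul_zero, add_zero] at h
    simpa using h.inv₀ one_ne_zero
  refine tendsto_of_tendsto_of_tendsto_of_le_of_le' hlow tendsto_const_nhds ?_ ?_
  · filter_upwards [eventually_gt_atTop 0] with r hr
    have hb := besselSeries_pos (ν := ν) (by linarith) (sq_nonneg r)
    have h := mul_besselSeries_add_one_lt (ν := ν + 1) (by linarith) hr
    have e := sq_mul_besselSeries_add_two (ν := ν) (by linarith) r
    have h' := mul_lt_mul_of_pos_left h hr
    have hν1 : 0 < ν + 1 := by linarith
    rw [show (1 + (ν + 1) * r⁻¹)⁻¹ = r / (r + (ν + 1)) by field_simp,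
      div_le_div_iff₀ (by positivity) hb]
    nlinarith
  · filter_upwards [eventually_gt_atTop 0] with r hr
    have hb := besselSeries_pos (ν := ν) (by linarith) (sq_nonneg r)
    rw [div_le_one hb]
    exact (mul_besselSeries_add_one_lt hν hr).le

/-- Solve the Wronskian identity for `besselSeries ν (r ^ 2)`: the other factor is `K_{ν+1}` plus
the ratio times `K_ν`, both at `2 r`, whose limits are known. -/
theorem tendsto_rpow_mul_exp_mul_besselSeries {ν : ℝ} (hν : -1 / 2 < ν) :
    Tendsto (fun r : ℝ => r ^ (ν + 1 / 2) * Real.exp (-(2 * r)) * besselSeries ν (r ^ 2)) atTop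
      (𝓝 (1 / (2 * √Real.pi))) := by
  have h2 : Tendsto (fun r : ℝ => 2 * r) atTop atTop := tendsto_id.const_mul_atTop two_pos
  have tA := (tendsto_sqrt_mul_exp_mul_macdonaldIntegral (ν + 1)).comp h2
  have tB := (tendsto_sqrt_mul_exp_mul_macdonaldIntegral ν).comp h2
  have hpi : 0 < √Real.pi := Real.sqrt_pos.2 Real.pi_pos
  have hq : 0 < √(2 : ℝ) := by positivity
  have t := (tendsto_const_nhds (x := √2)).div (tA.add ((tendsto_besselSeries_ratio hν).mul tB))
    (by rw [Real.sqrt_mul zero_le_two]; positivity)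
  rw [Real.sqrt_mul zero_le_two, show √2 / (√2 * √Real.pi + 1 * (√2 * √Real.pi)) =
    1 / (2 * √Real.pi) by field_simp; norm_num] at t
  refine t.congr' ?_
  filter_upwards [eventually_gt_atTop 0] with r hr
  have hb := besselSeries_pos (ν := ν) (by linarith) (sq_nonneg r)
  have hd := besselSeries_pos (ν := ν + 1) (by linarith) (sq_nonneg r)
  have hA := macdonaldIntegral_pos (ν + 1) (by positivity : 0 < 2 * r)
  have hB := macdonaldIntegral_pos ν (by positivity : 0 < 2 * r)
  have hw := besselSeries_wronskian hν hr
  have hsr : 0 < √r := Real.sqrt_pos.2 hr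
  rw [show ν + 1 = (ν + 1 / 2) + 1 / 2 by ring, Real.rpow_add hr, ← Real.sqrt_eq_rpow,
    show (ν + 1 / 2) + 1 / 2 = ν + 1 by ring] at hw
  simp only [Pi.div_apply, Function.comp_apply]
  rw [Real.sqrt_mul zero_le_two, Real.exp_neg]
  have he := Real.exp_pos (2 * r)
  generalize besselSeries ν (r ^ 2) = b at *
  generalize besselSeries (ν + 1) (r ^ 2) = d at *
  generalize macdonaldIntegral ν (2 * r) = B at *
  generalize macdonaldIntegral (ν + 1) (2 * r) = A at *
  generalize r ^ (ν + 1 / 2) = p at *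
  generalize Real.exp (2 * r) = E at *
  rw [div_eq_iff (by positivity)]
  field_simp
  linear_combination -hw

/-! ### The weight function. -/

theorem weight_eq (n : ℕ) (s α : ℝ) {r : ℝ} (hr : 0 < r) :
    weight n s α r = (r ^ s * macdonaldIntegral s r) ^ 2 *
      ((2 : ℝ) ^ (-(α + (n : ℝ) / 2 - 1)) / 4 * besselSeries (α + (n : ℝ) / 2 - 1) (r ^ 2)) := by
  rw [weight, besselI_two_mul _ hr, macdonaldK_eq s hr, sq_abs, mul_comm 2 s, Real.rpow_mul hr.le,
    Real.mul_rpow zero_le_two hr.le, Real.rpow_neg zero_le_two, Real.rpow_two]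
  have h1 := Real.rpow_pos_of_pos hr (α + (n : ℝ) / 2 - 1)
  have h2 := Real.rpow_pos_of_pos (zero_lt_two (α := ℝ)) (α + (n : ℝ) / 2 - 1)
  field_simp
  ring

theorem hasDerivAt_rpow_mul_macdonaldIntegral (s : ℝ) {r : ℝ} (hr : 0 < r) :
    HasDerivAt (fun x => x ^ s * macdonaldIntegral s x)
      (-(r ^ s * macdonaldIntegral (s - 1) r)) r := by
  refine ((Real.hasDerivAt_rpow_const (x := r) (p := s) (Or.inl hr.ne')).mul
    (hasDerivAt_macdonaldIntegral' s hr)).congr_deriv ?_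
  rw [Real.rpow_sub_one hr.ne']
  field_simp
  ring

theorem weight_strictAntiOn {n : ℕ} {s α : ℝ} (hs : 0 < s)
    (hν : -1 / 2 < α + (n : ℝ) / 2 - 1) (hsν : 2 * s - 3 / 2 ≤ α + (n : ℝ) / 2 - 1) :
    StrictAntiOn (weight n s α) (Ioi 0) := by
  set ν := α + (n : ℝ) / 2 - 1 with hνdef
  set C : ℝ := (2 : ℝ) ^ (-ν) / 4
  have hC : 0 < C := by positivity
  have hd : ∀ r : ℝ, 0 < r → HasDerivAt
      (fun x => (x ^ s * macdonaldIntegral s x) ^ 2 * (C * besselSeries ν (x ^ 2)))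
      (2 * C * (r ^ s) ^ 2 * macdonaldIntegral s r *
        (r * besselSeries (ν + 1) (r ^ 2) * macdonaldIntegral s r -
          besselSeries ν (r ^ 2) * macdonaldIntegral (s - 1) r)) r := by
    intro r hr
    refine (((hasDerivAt_rpow_mul_macdonaldIntegral s hr).pow 2).mul
      ((hasDerivAt_besselSeries_sq (ν := ν) (by linarith) r).const_mul C)).congr_deriv ?_
    simp only [Pi.pow_apply]
    push_cast
    ring
  have hanti := strictAntiOn_of_deriv_neg (convex_Ioi (0 : ℝ))
    (fun r hr => (hd r hr).continuousAt.continuousWithinAt) fun r hr => by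
      have hr : 0 < r := by simpa using hr
      rw [(hd r hr).deriv]
      have h1 := macdonaldIntegral_pos s hr
      have h2 := besselSeries_mul_macdonaldIntegral_lt hν hs hsν hr
      exact mul_neg_of_pos_of_neg (by positivity) (by linarith)
  exact hanti.congr fun r hr => (weight_eq n s α hr).symm

theorem tendsto_weight_zero {n : ℕ} {s α : ℝ} (hs : 0 < s) (hν : -1 < α + (n : ℝ) / 2 - 1) :
    Tendsto (weight n s α) (𝓝[>] 0) (𝓝 ((2 : ℝ) ^ (-α - (n : ℝ) / 2 + 2 * s - 1) *
      (Real.Gamma s ^ 2 / Real.Gamma (α + (n : ℝ) / 2)))) := by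
  have tb := ((continuous_besselSeries_sq hν).tendsto 0).mono_left
    (nhdsWithin_le_nhds (s := Ioi 0))
  have t := ((tendsto_rpow_mul_macdonaldIntegral hs).pow 2).mul
    (tb.const_mul ((2 : ℝ) ^ (-(α + (n : ℝ) / 2 - 1)) / 4))
  rw [zero_pow two_ne_zero, besselSeries_zero, sub_add_cancel] at t
  have hval : (2 : ℝ) ^ (-α - (n : ℝ) / 2 + 2 * s - 1) =
      ((2 : ℝ) ^ s) ^ 2 * ((2 : ℝ) ^ (-(α + (n : ℝ) / 2 - 1)) / 4) := by
    rw [show -α - (n : ℝ) / 2 + 2 * s - 1 = s + s + -(α + (n : ℝ) / 2 - 1) - (2 : ℕ) by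
      push_cast; ring, Real.rpow_sub_natCast two_ne_zero, Real.rpow_add two_pos,
      Real.rpow_add two_pos]
    ring
  rw [hval]
  refine (t.congr' ?_).trans_eq ?_
  · filter_upwards [self_mem_nhdsWithin] with r hr
    exact (weight_eq n s α hr).symm
  · congr 1
    ring

theorem weight_isEquivalent {n : ℕ} {s α : ℝ} (hν : -1 / 2 < α + (n : ℝ) / 2 - 1) :
    IsEquivalent atTop (weight n s α) (fun r : ℝ =>
      √Real.pi / 4 * (2 : ℝ) ^ (-(α + (n : ℝ) / 2 - 1)) *
        r ^ (-(α + ((n : ℝ) + 1) / 2 - 2 * s))) := by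
  have hpi : 0 < √Real.pi := Real.sqrt_pos.2 Real.pi_pos
  have hC : 0 < √Real.pi / 4 * (2 : ℝ) ^ (-(α + (n : ℝ) / 2 - 1)) := by positivity
  have t := (((tendsto_sqrt_mul_exp_mul_macdonaldIntegral s).pow 2).mul
    (tendsto_rpow_mul_exp_mul_besselSeries hν)).const_mul
      ((√Real.pi / 4 * (2 : ℝ) ^ (-(α + (n : ℝ) / 2 - 1)))⁻¹ *
        ((2 : ℝ) ^ (-(α + (n : ℝ) / 2 - 1)) / 4))
  have hval : (√Real.pi / 4 * (2 : ℝ) ^ (-(α + (n : ℝ) / 2 - 1)))⁻¹ *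
        ((2 : ℝ) ^ (-(α + (n : ℝ) / 2 - 1)) / 4) *
        (√(2 * Real.pi) ^ 2 * (1 / (2 * √Real.pi))) = 1 := by
    rw [Real.sq_sqrt (by positivity)]
    have hsq := Real.sq_sqrt Real.pi_pos.le
    have h2 := Real.rpow_pos_of_pos (zero_lt_two (α := ℝ)) (-(α + (n : ℝ) / 2 - 1))
    field_simp
    linarith
  rw [hval] at t
  refine isEquivalent_of_tendsto_one (t.congr' ?_)
  filter_upwards [eventually_gt_atTop 0] with r hr
  rw [Pi.div_apply, weight_eq n s α hr]
  set ν := α + (n : ℝ) / 2 - 1 with hνdef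
  have hr1 := Real.rpow_pos_of_pos hr (-(α + ((n : ℝ) + 1) / 2 - 2 * s))
  have hexp : Real.exp r ^ 2 * Real.exp (-(2 * r)) = 1 := by
    rw [← Real.exp_nat_mul, ← Real.exp_add]
    simp
  have hpow : r * r ^ (ν + 1 / 2) * r ^ (-(α + ((n : ℝ) + 1) / 2 - 2 * s)) = (r ^ s) ^ 2 := by
    rw [pow_two, ← Real.rpow_add hr, mul_comm r, ← Real.rpow_add_one hr.ne', ← Real.rpow_add hr]
    congr 1
    rw [hνdef]
    ring
  rw [eq_div_iff (by positivity)]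
  have hsr := Real.sq_sqrt hr.le
  have h2 := Real.rpow_pos_of_pos (zero_lt_two (α := ℝ)) (-ν)
  rw [mul_pow, mul_pow, mul_pow, hsr, ← hpow]
  generalize Real.exp (-(2 * r)) = E at *
  field_simp
  linear_combination macdonaldIntegral s r ^ 2 * besselSeries ν (r ^ 2) * hexp

theorem proposition6p6 (n : ℕ) (hn : 1 ≤ n) :
    ∃ c : ℝ → ℝ, (∀ α : ℝ, 0 < α → 0 < c α) ∧
      ∀ s α : ℝ, 0 < s → max (2 * s - ((n : ℝ) + 1) / 2) 0 < α →
        (∀ r : ℝ, 0 < r → 0 < weight n s α r) ∧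
        StrictAntiOn (weight n s α) (Set.Ioi 0) ∧
        Tendsto (weight n s α) (𝓝[>] 0)
          (𝓝 ((2 : ℝ) ^ (-α - (n : ℝ) / 2 + 2 * s - 1) *
            (Real.Gamma s ^ 2 / Real.Gamma (α + (n : ℝ) / 2)))) ∧
        IsEquivalent atTop (weight n s α)
          (fun r : ℝ => c α * r ^ (-(α + ((n : ℝ) + 1) / 2 - 2 * s))) := by
  have hpi : 0 < √Real.pi := Real.sqrt_pos.2 Real.pi_pos
  refine ⟨fun α => √Real.pi / 4 * (2 : ℝ) ^ (-(α + (n : ℝ) / 2 - 1)), fun α _ => by positivity,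
    fun s α hs hα => ?_⟩
  obtain ⟨h1, h2⟩ := max_lt_iff.1 hα
  have hn' : (1 : ℝ) ≤ n := by exact_mod_cast hn
  -- This is where `n ≥ 1` enters.
  have hν : -1 / 2 < α + (n : ℝ) / 2 - 1 := by linarith
  refine ⟨fun r hr => ?_, weight_strictAntiOn hs hν (by linarith),
    tendsto_weight_zero hs (by linarith), weight_isEquivalent hν⟩
  rw [weight_eq n s α hr]
  have hb := besselSeries_pos (ν := α + (n : ℝ) / 2 - 1) (by linarith) (sq_nonneg r)
  have hE := macdonaldIntegral_pos s hr
  positivity
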